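/- Let $(M^n,g)$ be a simply connected, complete and irreducible Riemannian manifold with Levi-Civita connection $\nabla^g$, and let $\nabla$ be a smooth flat metric connection on $TM$ with totally skew-symmetric torsion, i.e. $g(\nabla_XY-\nabla_YX-[X,Y],Z)=g(T(X,Y),Z)=:T(X,Y,Z)$ is a $3$-form. (Irreducible means that $n\geq 1$ and that the zero distribution and $TM$ are the only $\nabla^g$-parallel distributions.) Let $\mathcal R^g(X,Y,Z,W)=g(\nabla^g_X\nabla^g_YZ-\nabla^g_Y\nabla^g_XZ-\nabla^g_{[X,Y]}Z,\,W)$ be the Riemannian curvature tensor. Then: 1. $\mathcal R^g$ is $\nabla$-parallel, $\nabla\mathcal R^g=0$, and $\nabla^g$-parallel, $\nabla^g\mathcal R^g=0$. 2. For every tangent vector $X$ one has $[X\lrcorner T,\mathcal R^g]=0$, where $X\lrcorner T$ is regarded as the skew endomorphism $A=T(X,\cdot)$ of the tangent space, acting on $4$-tensors by $[A,S](u,v,w,z)=-\big(S(Au,v,w,z)+S(u,Av,w,z)+S(u,v,Aw,z)+S(u,v,w,Az)\big)$. 3. If $e_1,\dots,e_n$ is a smooth $\nabla$-parallel orthonormal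 frame on a connected open set $U\subseteq M$, then every $e_i$ is a Killing vector field on $U$ and all the coefficients $\mathcal R^g(e_i,e_j,e_k,e_l)$ are constant on $U$. -/

import Mathlib

open Bundle FiberBundle VectorField
open scoped Manifold ContDiff Topology

/-! ## The Levi-Civita connection -/

noncomputable section LeviCivita

variable {E : Type*} [NormedAddCommGroup E] [NormedSpace ℝ E] [FiniteDimensional ℝ E]
  {H : Type*} [TopologicalSpace H] (I : ModelWithCorners ℝ E H)
  {M : Type*} [TopologicalSpace M] [ChartedSpace H M] [IsManifold I ∞ M]
  [RiemannianBundle (fun (x : M) ↦ TangentSpace I x)]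

/-- The right-hand side of the Koszul formula, i.e. the prescribed value of `g(∇^g_X Y, Z)`. -/
def koszul (X Y Z : Π x : M, TangentSpace I x) (x : M) : ℝ :=
  (1 / 2 : ℝ) *
    (d% (fun y ↦ inner ℝ (Y y) (Z y)) x (X x)
      + d% (fun y ↦ inner ℝ (X y) (Z y)) x (Y x)
      - d% (fun y ↦ inner ℝ (X y) (Y y)) x (Z x)
      + inner ℝ (mlieBracket I X Y x) (Z x)
      - inner ℝ (mlieBracket I X Z x) (Y x)
      - inner ℝ (mlieBracket I Y Z x) (X x))

variable [IsContMDiffRiemannianBundle I ∞ E (fun (x : M) ↦ TangentSpace I x)]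

theorem mdifferentiableAt_inner {x : M} {X Y : Π x : M, TangentSpace I x}
    (hX : MDiffAt (T% X) x) (hY : MDiffAt (T% Y) x) :
    MDiffAt (fun y ↦ inner ℝ (X y) (Y y)) x :=
  MDifferentiableAt.inner_bundle (E := fun x : M ↦ TangentSpace I x) (F := E) (b := fun y ↦ y)
    hX hY

theorem koszul_tensorial_left {x : M} {Y Z : Π x : M, TangentSpace I x}
    (hY : MDiffAt (T% Y) x) (hZ : MDiffAt (T% Z) x) :
    TensorialAt I E (fun X ↦ koszul I X Y Z x) x where
  smul {f X} hf hX := by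
    have e1 := mvfderiv_fun_mul hf (mdifferentiableAt_inner I hX hZ)
    have e2 := mvfderiv_fun_mul hf (mdifferentiableAt_inner I hX hY)
    simp [koszul, inner_smul_left, inner_smul_right, e1, e2, mlieBracket_smul_left hf hX, inner_add_left]
    ring
  add {X X'} hX hX' := by
    have e1 := mvfderiv_fun_add (mdifferentiableAt_inner I hX hZ) (mdifferentiableAt_inner I hX' hZ)
    have e2 := mvfderiv_fun_add (mdifferentiableAt_inner I hX hY) (mdifferentiableAt_inner I hX' hY)
    simp [koszul, inner_add_left, inner_add_right, e1, e2, mlieBracket_add_left hX hX']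
    ring

theorem koszul_tensorial_right {x : M} {X Y : Π x : M, TangentSpace I x}
    (hX : MDiffAt (T% X) x) (hY : MDiffAt (T% Y) x) :
    TensorialAt I E (fun Z ↦ koszul I X Y Z x) x where
  smul {f Z} hf hZ := by
    have e1 := mvfderiv_fun_mul hf (mdifferentiableAt_inner I hY hZ)
    have e2 := mvfderiv_fun_mul hf (mdifferentiableAt_inner I hX hZ)
    simp [koszul, inner_smul_left, inner_smul_right, e1, e2, mlieBracket_smul_right hf hZ,
      inner_add_left, real_inner_comm]
    ring
  add {Z Z'} hZ hZ' := by
    have e1 := mvfderiv_fun_add (mdifferentiableAt_inner I hY hZ) (mdifferentiableAt_inner I hY hZ')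
    have e2 := mvfderiv_fun_add (mdifferentiableAt_inner I hX hZ) (mdifferentiableAt_inner I hX hZ')
    simp [koszul, inner_add_left, inner_add_right, e1, e2, mlieBracket_add_right hZ hZ']
    ring

/-- For a vector field `Y` that is differentiable at `x`, the bilinear form
`(u, v) ↦ g(∇^g_u Y, v)` on the tangent space at `x`. -/
def koszulForm (Y : Π x : M, TangentSpace I x) (x : M) (hY : MDiffAt (T% Y) x) :
    TangentSpace I x →L[ℝ] TangentSpace I x →L[ℝ] ℝ :=
  TensorialAt.mkHom₂ (fun X Z ↦ koszul I X Y Z x) x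
    (fun _ hZ ↦ koszul_tensorial_left I hY hZ) (fun _ hX ↦ koszul_tensorial_right I hX hY)

open scoped Classical in
/-- The Levi-Civita derivative of a vector field (zero, by convention, where the field is not
differentiable). -/
def leviCivitaFun (Y : Π x : M, TangentSpace I x) (x : M) :
    TangentSpace I x →L[ℝ] TangentSpace I x :=
  haveI : FiniteDimensional ℝ (TangentSpace I x) := inferInstanceAs (FiniteDimensional ℝ E)
  haveI : CompleteSpace (TangentSpace I x) := FiniteDimensional.complete ℝ _
  if hY : MDiffAt (T% Y) x then
    (InnerProductSpace.toDual ℝ (TangentSpace I x)).symm.toContinuousLinearEquiv.toContinuousLinearMap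
      ∘L koszulForm I Y x hY
  else 0

theorem inner_leviCivitaFun {x : M} {X Y Z : Π x : M, TangentSpace I x}
    (hX : MDiffAt (T% X) x) (hY : MDiffAt (T% Y) x) (hZ : MDiffAt (T% Z) x) :
    inner ℝ (leviCivitaFun I Y x (X x)) (Z x) = koszul I X Y Z x := by
  have : FiniteDimensional ℝ (TangentSpace I x) := inferInstanceAs (FiniteDimensional ℝ E)
  have : CompleteSpace (TangentSpace I x) := FiniteDimensional.complete ℝ _
  simp only [leviCivitaFun, hY, dite_true]
  have := TensorialAt.mkHom₂_apply (fun _ hZ ↦ koszul_tensorial_left I hY hZ)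
    (fun _ hX ↦ koszul_tensorial_right I hX hY) hX hZ
  rw [← this]
  exact InnerProductSpace.toDual_symm_apply

theorem leviCivitaFun_ext {x : M} {A B : TangentSpace I x →L[ℝ] TangentSpace I x}
    (h : ∀ X Z : Π x : M, TangentSpace I x, MDiffAt (T% X) x → MDiffAt (T% Z) x →
      inner ℝ (A (X x)) (Z x) = inner ℝ (B (X x)) (Z x)) : A = B := by
  ext u
  refine ext_inner_right ℝ fun v ↦ ?_
  simpa using h (extend E u) (extend E v) (mdifferentiableAt_extend ..)
    (mdifferentiableAt_extend ..)

/-- The Levi-Civita connection of a Riemannian manifold, built from the Koszul formula. -/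
def leviCivita : CovariantDerivative I E (fun x : M ↦ TangentSpace I x) where
  toFun := leviCivitaFun I
  isCovariantDerivativeOnUniv :=
    { add := by
        intro Y Y' x hY hY' _
        apply leviCivitaFun_ext
        intro X Z hX hZ
        have e1 := mvfderiv_fun_add (mdifferentiableAt_inner I hY hZ)
          (mdifferentiableAt_inner I hY' hZ)
        have e2 := mvfderiv_fun_add (mdifferentiableAt_inner I hX hY)
          (mdifferentiableAt_inner I hX hY')
        rw [add_apply, inner_add_left, inner_leviCivitaFun I hX hY hZ,
          inner_leviCivitaFun I hX hY' hZ,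
          inner_leviCivitaFun I hX (mdifferentiableAt_add_section hY hY') hZ]
        simp [koszul, inner_add_left, inner_add_right, e1, e2, mlieBracket_add_left hY hY',
          mlieBracket_add_right hY hY']
        ring
      leibniz := by
        intro Y f x hY hf _
        apply leviCivitaFun_ext
        intro X Z hX hZ
        have e1 := mvfderiv_fun_mul hf (mdifferentiableAt_inner I hY hZ)
        have e2 := mvfderiv_fun_mul hf (mdifferentiableAt_inner I hX hY)
        rw [add_apply, inner_add_left, smul_apply,
          inner_smul_left, inner_leviCivitaFun I hX hY hZ,
          inner_leviCivitaFun I hX (hf.smul_section hY) hZ]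
        simp [koszul, inner_add_left, inner_smul_left, inner_smul_right, e1, e2,
          mlieBracket_smul_left hf hY, mlieBracket_smul_right hf hY, real_inner_comm (X x) (Y x)]
        ring }

theorem inner_leviCivita {x : M} {X Y Z : Π x : M, TangentSpace I x}
    (hX : MDiffAt (T% X) x) (hY : MDiffAt (T% Y) x) (hZ : MDiffAt (T% Z) x) :
    inner ℝ (leviCivita I Y x (X x)) (Z x) = koszul I X Y Z x :=
  inner_leviCivitaFun I hX hY hZ

/-- The Levi-Civita connection is torsion-free. -/
theorem leviCivita_torsion : (leviCivita I (M := M)).torsion = 0 := by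
  rw [CovariantDerivative.torsion_eq_zero_iff]
  intro X Y x hX hY
  refine ext_inner_right ℝ fun v ↦ ?_
  have hZ := mdifferentiableAt_extend I E v
  have h1 := inner_leviCivita I hX hY hZ
  have h2 := inner_leviCivita I hY hX hZ
  simp only [extend_apply_self] at h1 h2
  rw [inner_sub_left, h1, h2, koszul, koszul, mlieBracket_swap_apply (V := Y) (W := X)]
  simp [real_inner_comm]
  ring

end LeviCivita

/-! ## Metric connections, torsion and curvature -/

noncomputable section Connections

variable {E : Type*} [NormedAddCommGroup E] [NormedSpace ℝ E] [FiniteDimensional ℝ E]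
  {H : Type*} [TopologicalSpace H] {I : ModelWithCorners ℝ E H}
  {M : Type*} [TopologicalSpace M] [ChartedSpace H M] [IsManifold I ∞ M]

/-- The connection is metric: `u g(X, Y) = g(∇_u X, Y) + g(X, ∇_u Y)`. -/
def IsMetricConnection [RiemannianBundle (fun (x : M) ↦ TangentSpace I x)]
    (cov : CovariantDerivative I E (fun x : M ↦ TangentSpace I x)) : Prop :=
  ∀ (x : M) (u : TangentSpace I x) (X Y : Π y : M, TangentSpace I y),
    MDiffAt (T% X) x → MDiffAt (T% Y) x →
      d% (fun y ↦ inner ℝ (X y) (Y y)) x u = inner ℝ (cov X x u) (Y x) + inner ℝ (X x) (cov Y x u)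

/-- The Levi-Civita connection is metric. -/
theorem leviCivita_isMetricConnection [RiemannianBundle (fun (x : M) ↦ TangentSpace I x)]
    [IsContMDiffRiemannianBundle I ∞ E (fun (x : M) ↦ TangentSpace I x)] :
    IsMetricConnection (leviCivita I (M := M)) := by
  intro x u Y Z hY hZ
  have hX := mdifferentiableAt_extend I E u
  have h1 := inner_leviCivita I hX hY hZ
  have h2 := inner_leviCivita I hX hZ hY
  rw [real_inner_comm] at h2
  simp only [extend_apply_self] at h1 h2
  simp only [h1, h2, koszul, mlieBracket_swap_apply (V := Z) (W := Y)]
  simp [real_inner_comm]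
  ring

/-- The torsion, viewed as the `(3,0)`-tensor `T(X, Y, Z) = g(T(X, Y), Z)`, is a `3`-form: it is
antisymmetric in all its arguments. -/
def HasSkewTorsion [RiemannianBundle (fun (x : M) ↦ TangentSpace I x)]
    (cov : CovariantDerivative I E (fun x : M ↦ TangentSpace I x)) : Prop :=
  ∀ (x : M) (u v w : TangentSpace I x),
    inner ℝ (cov.torsion x u v) w = - inner ℝ (cov.torsion x v u) w ∧
    inner ℝ (cov.torsion x u v) w = - inner ℝ (cov.torsion x u w) v

/-- The curvature operator on vector fields:
`R(X, Y) Z = ∇_X ∇_Y Z - ∇_Y ∇_X Z - ∇_[X, Y] Z`. -/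
def curvatureField (cov : CovariantDerivative I E (fun x : M ↦ TangentSpace I x))
    (X Y Z : Π x : M, TangentSpace I x) (x : M) : TangentSpace I x :=
  cov (fun y ↦ cov Z y (Y y)) x (X x) - cov (fun y ↦ cov Z y (X y)) x (Y x)
    - cov Z x (mlieBracket I X Y x)

/-- The curvature tensor `R(u, v) w` of a smooth connection at a point, computed by extending the
three tangent vectors to vector fields that are smooth near the point. -/
def curvatureTensor (cov : CovariantDerivative I E (fun x : M ↦ TangentSpace I x))
    (x : M) (u v w : TangentSpace I x) : TangentSpace I x :=
  curvatureField cov (extend E u) (extend E v) (extend E w) x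

/-- The connection is flat: its curvature vanishes. -/
def IsFlatConnection (cov : CovariantDerivative I E (fun x : M ↦ TangentSpace I x)) : Prop :=
  ∀ (x : M) (u v w : TangentSpace I x), curvatureTensor cov x u v w = 0

variable (I) in
/-- The Riemannian curvature tensor as a `(4,0)`-tensor: `R^g(u, v, w, z) = g(R^g(u, v) w, z)`,
where `R^g(u, v) w` is the curvature of the Levi-Civita connection. -/
def riemannTensor [RiemannianBundle (fun (x : M) ↦ TangentSpace I x)]
    [IsContMDiffRiemannianBundle I ∞ E (fun (x : M) ↦ TangentSpace I x)]
    (x : M) (u v w z : TangentSpace I x) : ℝ :=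
  inner ℝ (curvatureTensor (leviCivita I) x u v w) z

/-- The covariant derivative of a `(4,0)`-tensor field `S` in the direction `v` at `x`, evaluated
on vector fields: `(∇_v S)(X, Y, Z, W) = v(S(X, Y, Z, W)) - S(∇_v X, Y, Z, W) - …`. -/
def covDerivTensor (cov : CovariantDerivative I E (fun x : M ↦ TangentSpace I x))
    (S : Π x : M, TangentSpace I x → TangentSpace I x → TangentSpace I x → TangentSpace I x → ℝ)
    (x : M) (v : TangentSpace I x) (X Y Z W : Π x : M, TangentSpace I x) : ℝ :=
  d% (fun y ↦ S y (X y) (Y y) (Z y) (W y)) x v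
    - S x (cov X x v) (Y x) (Z x) (W x)
    - S x (X x) (cov Y x v) (Z x) (W x)
    - S x (X x) (Y x) (cov Z x v) (W x)
    - S x (X x) (Y x) (Z x) (cov W x v)

/-- The `(4,0)`-tensor field `S` is smooth and parallel: `∇S = 0`. -/
def IsParallelTensor (cov : CovariantDerivative I E (fun x : M ↦ TangentSpace I x))
    (S : Π x : M, TangentSpace I x → TangentSpace I x → TangentSpace I x → TangentSpace I x → ℝ) :
    Prop :=
  ∀ X Y Z W : Π x : M, TangentSpace I x,
    CMDiff ∞ (T% X) → CMDiff ∞ (T% Y) → CMDiff ∞ (T% Z) → CMDiff ∞ (T% W) →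
      CMDiff ∞ (fun y ↦ S y (X y) (Y y) (Z y) (W y)) ∧
      ∀ (x : M) (v : TangentSpace I x), covDerivTensor cov S x v X Y Z W = 0

/-- The bracket `[A, S]`, i.e. the action of an endomorphism `A` of a tangent space on a
`(4,0)`-tensor `S` as a derivation of the tensor algebra. -/
def tensorBracket {x : M} (A : TangentSpace I x →L[ℝ] TangentSpace I x)
    (S : TangentSpace I x → TangentSpace I x → TangentSpace I x → TangentSpace I x → ℝ)
    (u v w z : TangentSpace I x) : ℝ :=
  - (S (A u) v w z + S u (A v) w z + S u v (A w) z + S u v w (A z))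

/-! ## Irreducibility -/

/-- A smooth subbundle `D` of the tangent bundle that is invariant under the connection. -/
structure IsParallelDistribution (cov : CovariantDerivative I E (fun x : M ↦ TangentSpace I x))
    (D : Π x : M, Submodule ℝ (TangentSpace I x)) : Prop where
  rank : ∃ k : ℕ, ∀ x, Module.finrank ℝ (D x) = k
  smooth : ∀ x, ∀ v ∈ D x, ∃ Y : Π y : M, TangentSpace I y,
    CMDiff ∞ (T% Y) ∧ (∀ y, Y y ∈ D y) ∧ Y x = v
  parallel : ∀ Y : Π y : M, TangentSpace I y, CMDiff ∞ (T% Y) → (∀ y, Y y ∈ D y) →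
    ∀ (x : M) (u : TangentSpace I x), cov Y x u ∈ D x

variable (I M) in
/-- A (connected) Riemannian manifold of positive dimension is irreducible if its holonomy
representation is irreducible, i.e. if the only distributions that are parallel for the Levi-Civita
connection are the zero distribution and the whole tangent bundle. -/
def IsIrreducibleRiemannian [RiemannianBundle (fun (x : M) ↦ TangentSpace I x)]
    [IsContMDiffRiemannianBundle I ∞ E (fun (x : M) ↦ TangentSpace I x)] : Prop :=
  0 < Module.finrank ℝ E ∧
  ∀ D : Π x : M, Submodule ℝ (TangentSpace I x),
    IsParallelDistribution (leviCivita I (M := M)) D → (∀ x, D x = ⊥) ∨ (∀ x, D x = ⊤)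

/-! ## Parallel frames and Killing fields -/

/-- On the set `U`, the vector fields `e i` are smooth, `∇`-parallel, and form an orthonormal basis
of every tangent space. -/
structure IsParallelOrthonormalFrameOn [RiemannianBundle (fun (x : M) ↦ TangentSpace I x)]
    (cov : CovariantDerivative I E (fun x : M ↦ TangentSpace I x)) (U : Set M)
    (e : Fin (Module.finrank ℝ E) → Π x : M, TangentSpace I x) : Prop where
  smooth : ∀ i, CMDiff[U] ∞ (T% (e i))
  parallel : ∀ i, ∀ x ∈ U, cov (e i) x = 0
  orthonormal : ∀ x ∈ U, Orthonormal ℝ (fun i ↦ e i x)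

/-- `X` is a Killing vector field on `U`: `g(∇^g_u X, v) + g(u, ∇^g_v X) = 0`. -/
def IsKillingOn [RiemannianBundle (fun (x : M) ↦ TangentSpace I x)]
    [IsContMDiffRiemannianBundle I ∞ E (fun (x : M) ↦ TangentSpace I x)]
    (X : Π x : M, TangentSpace I x) (U : Set M) : Prop :=
  ∀ x ∈ U, ∀ u v : TangentSpace I x,
    inner ℝ (leviCivita I X x u) v + inner ℝ u (leviCivita I X x v) = 0

end Connections

/-!
Write `A_X = T(X, ⋅)` for the skew endomorphisms given by the torsion. The argument is local and
purely algebraic once the following three facts are known.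

* The Levi-Civita connection is `∇ - T/2` (`leviCivita_apply_eq`).
* `∇_X T = (1/3) A_X ⋅ T` (`covDeriv_torsion`). By the first Bianchi identity for the flat connection
  `∇` (`bianchi_of_flat`), the cyclic sum of `(∇_X T)(Y, Z)` is quadratic in `T`, and it is a
  `4`-form; as `∇T` is skew in its last three arguments, it is a third of this cyclic sum
  (`three_mul_eq_of_cyclic_sum`).
* `[A_X, A_Y] + A_{T(X, Y)}` is a derivation of the product `T` on each tangent space
  (`torsion_derivation`). This is the vanishing of the curvature of `∇` on the fields `T(Z, W)`,
  with all derivatives of `T` expressed by the second fact.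

The first two facts give `R^g(X, Y) = -(1/12) ([A_X, A_Y] + 2 A_{T(X, Y)})`
(`curvature_sub_half_smul`, `riemannTensor_apply`). The third one implies that every `A_X` is a
derivation of the triple product on the right-hand side (`derivation_tripleProduct`); this is a
linear consequence of the derivation property, known from the Lie triple systems of Malcev algebras.
As `A_X` is skew, it follows that `[A_X, R^g] = 0`. Since `R^g` is quadratic in `T`, the connection
`∇_X` acts on it as `(1/3) A_X`, and `∇^g_X` as `(1/3 - 1/2) A_X`; so `R^g` is parallel for both.
A `∇`-parallel field `e` has `∇^g_u e = -T(u, e) / 2`, so it is Killing, and the coefficients of a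
`∇`-parallel tensor in a `∇`-parallel frame have zero derivative.

The identities are proved in the real vector space of globally smooth vector fields, so that the
covariant derivative and the torsion are bilinear operations on one space. This needs the flatness of
`∇` on all smooth fields, that is, the tensoriality of the curvature (`curvature_congr`).
-/

/-! ### Flat connections with torsion: the algebra -/

section Algebra

/-! The lemmas of this section are identities between two bilinear operations on a real vector
space `V`. They are applied to the space of smooth vector fields, with `D X Y = ∇_X Y` and
`T X Y = T(X, Y)`; then `D X Y - D Y X - T X Y` is the Lie bracket. -/

variable {V : Type*} [AddCommGroup V] [Module ℝ V] {D T : V →ₗ[ℝ] V →ₗ[ℝ] V}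

/-- The first Bianchi identity of a flat connection with torsion: the cyclic sum of
`(∇_X T)(Y, Z)` is minus the cyclic sum of `T(T(X, Y), Z)`. It rewrites the Jacobi identity of the
Lie bracket. -/
theorem bianchi_of_flat (hT : ∀ X Y, T X Y = -T Y X)
    (hflat : ∀ X Y Z, D X (D Y Z) - D Y (D X Z) - D (D X Y - D Y X - T X Y) Z = 0)
    {b : V → V → V} (hb : ∀ X Y, b X Y = D X Y - D Y X - T X Y)
    (hjac : ∀ X Y Z, b X (b Y Z) = b (b X Y) Z + b Y (b X Z)) (X Y Z : V) :
    (D X (T Y Z) - T (D X Y) Z - T Y (D X Z)) + (D Y (T Z X) - T (D Y Z) X - T Z (D Y X)) +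
      (D Z (T X Y) - T (D Z X) Y - T X (D Z Y)) =
      -(T (T X Y) Z + T (T Y Z) X + T (T Z X) Y) := by
  have h1 := hflat X Y Z
  have h2 := hflat Y Z X
  have h3 := hflat Z X Y
  have h := hjac X Y Z
  simp only [hb, map_sub, LinearMap.sub_apply, hT X Z, hT (D _ _) X, hT (D _ _) Y,
    hT (D _ _) Z, hT (T _ _) X, hT (T _ _) Y, hT (T _ _) Z, map_neg, LinearMap.neg_apply]
    at h h1 h2 h3 ⊢
  linear_combination (norm := module) h1 + h2 + h3 - h

/-- If `∇` is flat and `∇_X T = (1/3) A_X ⋅ T`, where `A_X = T(X, ⋅)`, then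
`[A_X, A_Y] + A_{T(X, Y)}` is a derivation of the product `T`. -/
theorem torsion_derivation (hT : ∀ X Y, T X Y = -T Y X)
    (hflat : ∀ X Y Z, D X (D Y Z) - D Y (D X Z) - D (D X Y - D Y X - T X Y) Z = 0)
    (hDT : ∀ X Y Z, D X (T Y Z) = T (D X Y) Z + T Y (D X Z) +
      (1 / 3 : ℝ) • (T X (T Y Z) - T (T X Y) Z - T Y (T X Z))) (X Y Z W : V) :
    T X (T Y (T Z W)) - T Y (T X (T Z W)) + T (T X Y) (T Z W) =
      T (T X (T Y Z) - T Y (T X Z) + T (T X Y) Z) W +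
      T Z (T X (T Y W) - T Y (T X W) + T (T X Y) W) := by
  -- The curvature acts on tensors as a derivation, and it vanishes on `Z`, `W` and `T(Z, W)`.
  have h1 := hflat X Y (T Z W)
  have h2 := congrArg (fun F ↦ T F W) (hflat X Y Z)
  have h3 := congrArg (fun F ↦ T Z F) (hflat X Y W)
  simp only [hDT, map_sub, map_add, map_smul, LinearMap.sub_apply, LinearMap.add_apply,
    LinearMap.smul_apply, map_zero, LinearMap.zero_apply, hT Y X, map_neg, LinearMap.neg_apply]
    at h1 h2 h3 ⊢
  linear_combination (norm := module) (9 : ℝ) • (h1 - h2 - h3)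

/-- The triple product `[A_X, A_Y] Z + 2 A_{T(X, Y)} Z` of an algebra with product `T` and left
multiplications `A_X = T(X, ⋅)`. For a Malcev algebra it is, up to a constant, the Lie triple
product of Loos. -/
def tripleProduct (T : V →ₗ[ℝ] V →ₗ[ℝ] V) (X Y Z : V) : V :=
  T X (T Y Z) - T Y (T X Z) + (2 : ℝ) • T (T X Y) Z

/-- If all the operators `[A_X, A_Y] + A_{T(X, Y)}` are derivations of the skew product `T`, then
every left multiplication `A_X` is a derivation of the triple product. The identity to be proved is
a linear combination of three instances of the hypothesis. -/
theorem derivation_tripleProduct (hT : ∀ X Y, T X Y = -T Y X)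
    (h : ∀ X Y Z W, T X (T Y (T Z W)) - T Y (T X (T Z W)) + T (T X Y) (T Z W) =
      T (T X (T Y Z) - T Y (T X Z) + T (T X Y) Z) W +
      T Z (T X (T Y W) - T Y (T X W) + T (T X Y) W)) (X Y Z W : V) :
    T X (tripleProduct T Y Z W) = tripleProduct T (T X Y) Z W + tripleProduct T Y (T X Z) W +
      tripleProduct T Y Z (T X W) := by
  have h1 := h X Z Y W
  have h2 := h X Y Z W
  have h3 := h Y Z X W
  simp only [tripleProduct, map_sub, map_add, map_smul, LinearMap.sub_apply, LinearMap.add_apply,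
    hT Y X, hT Z X, hT Z Y, hT (T _ _) X, hT (T _ _) Y, hT (T _ _) Z, hT (T _ _) W,
    map_neg, LinearMap.neg_apply] at h1 h2 h3 ⊢
  linear_combination (norm := module) h1 - h2 - (2 : ℝ) • h3

/-- The curvature of `∇ - T/2` is `-1/12` times the triple product, when `∇` is flat and
`∇_X T = (1/3) A_X ⋅ T`. -/
theorem curvature_sub_half_smul (hT : ∀ X Y, T X Y = -T Y X)
    (hflat : ∀ X Y Z, D X (D Y Z) - D Y (D X Z) - D (D X Y - D Y X - T X Y) Z = 0)
    (hDT : ∀ X Y Z, D X (T Y Z) = T (D X Y) Z + T Y (D X Z) +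
      (1 / 3 : ℝ) • (T X (T Y Z) - T (T X Y) Z - T Y (T X Z)))
    {G : V →ₗ[ℝ] V →ₗ[ℝ] V} (hG : G = D - (1 / 2 : ℝ) • T) (X Y Z : V) :
    G X (G Y Z) - G Y (G X Z) - G (D X Y - D Y X - T X Y) Z =
      -(1 / 12 : ℝ) • tripleProduct T X Y Z := by
  have h1 := hflat X Y Z
  simp only [hG, hDT, tripleProduct, map_sub, map_smul, LinearMap.sub_apply, LinearMap.smul_apply,
    hT Y X, map_neg, LinearMap.neg_apply] at h1 ⊢
  linear_combination (norm := module) h1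

/-- The triple product is quadratic in `T`, so `∇_X T = (1/3) A_X ⋅ T` shows that `∇_X` acts on it as
`(1/3) A_X` does, that is, trivially. -/
theorem covDeriv_tripleProduct
    (hDT : ∀ X Y Z, D X (T Y Z) = T (D X Y) Z + T Y (D X Z) +
      (1 / 3 : ℝ) • (T X (T Y Z) - T (T X Y) Z - T Y (T X Z)))
    (hTR : ∀ X Y Z W, T X (tripleProduct T Y Z W) = tripleProduct T (T X Y) Z W +
      tripleProduct T Y (T X Z) W + tripleProduct T Y Z (T X W)) (X Y Z W : V) :
    D X (tripleProduct T Y Z W) = tripleProduct T (D X Y) Z W + tripleProduct T Y (D X Z) W +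
      tripleProduct T Y Z (D X W) := by
  have h1 := hTR X Y Z W
  simp only [tripleProduct, hDT, map_sub, map_add, map_smul, LinearMap.sub_apply,
    LinearMap.add_apply, LinearMap.smul_apply] at h1 ⊢
  linear_combination (norm := module) (1 / 3 : ℝ) • h1

theorem sub_half_smul_tripleProduct
    (hD : ∀ X Y Z W, D X (tripleProduct T Y Z W) = tripleProduct T (D X Y) Z W +
      tripleProduct T Y (D X Z) W + tripleProduct T Y Z (D X W))
    (hT : ∀ X Y Z W, T X (tripleProduct T Y Z W) = tripleProduct T (T X Y) Z W +
      tripleProduct T Y (T X Z) W + tripleProduct T Y Z (T X W))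
    {G : V →ₗ[ℝ] V →ₗ[ℝ] V} (hG : G = D - (1 / 2 : ℝ) • T) (X Y Z W : V) :
    G X (tripleProduct T Y Z W) = tripleProduct T (G X Y) Z W + tripleProduct T Y (G X Z) W +
      tripleProduct T Y Z (G X W) := by
  have h1 := hD X Y Z W
  have h2 := hT X Y Z W
  simp only [hG, LinearMap.sub_apply, LinearMap.smul_apply, h1, h2]
  simp only [tripleProduct, map_sub, map_smul, LinearMap.sub_apply, LinearMap.smul_apply]
  module

end Algebra

/-! ### The space of smooth vector fields -/

noncomputable section Fields

variable {E : Type*} [NormedAddCommGroup E] [NormedSpace ℝ E]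
  {H : Type*} [TopologicalSpace H] {I : ModelWithCorners ℝ E H}
  {M : Type*} [TopologicalSpace M] [ChartedSpace H M] [IsManifold I ∞ M]

variable (I M) in
/-- The real vector space of smooth vector fields on `M`. -/
abbrev SmoothVectorField : Type _ := Cₛ^∞⟮I; E, fun x : M ↦ TangentSpace I x⟯

namespace SmoothVectorField

theorem mdiffAt (X : SmoothVectorField I M) (x : M) : MDiffAt (T% fun y ↦ X y) x :=
  X.mdifferentiableAt

/-- `covDeriv cov h X Y = ∇_X Y` as a bilinear map on smooth vector fields. -/
def covDeriv (cov : CovariantDerivative I E (fun x : M ↦ TangentSpace I x))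
    (h : cov.ContMDiffCovariantDerivative ∞) :
    SmoothVectorField I M →ₗ[ℝ] SmoothVectorField I M →ₗ[ℝ] SmoothVectorField I M :=
  LinearMap.mk₂ ℝ
    (fun X Y ↦ ⟨fun x ↦ cov Y x (X x), by
      have hY := (h.contMDiff.contMDiff (σ := Y) (by simpa using Y.contMDiff.contMDiffOn))
      exact (contMDiffOn_univ.mp hY).clm_bundle_apply X.contMDiff⟩)
    (by intros; ext; simp)
    (by intros; ext; simp)
    (by
      intro X Y Z; ext x
      exact congrArg (fun F ↦ F (X x)) (cov.isCovariantDerivativeOnUniv.add (Y.mdiffAt x) (Z.mdiffAt x)))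
    (by
      intro c X Y; ext x
      exact congrArg (fun F ↦ F (X x)) (cov.isCovariantDerivativeOnUniv.smul_const c (Y.mdiffAt x)))

@[simp]
theorem covDeriv_apply (cov : CovariantDerivative I E (fun x : M ↦ TangentSpace I x))
    (h : cov.ContMDiffCovariantDerivative ∞) (X Y : SmoothVectorField I M) (x : M) :
    covDeriv cov h X Y x = cov Y x (X x) := rfl

/-- The product of a smooth function and a smooth vector field. -/
def smulFun (f : M → ℝ) (hf : CMDiff ∞ f) (X : SmoothVectorField I M) : SmoothVectorField I M :=
  ⟨f • (X : Π x : M, TangentSpace I x), hf.smul_section X.contMDiff⟩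

@[simp]
theorem smulFun_apply (f : M → ℝ) (hf : CMDiff ∞ f) (X : SmoothVectorField I M) (x : M) :
    smulFun f hf X x = f x • X x := rfl

theorem covDeriv_smulFun_left (cov : CovariantDerivative I E (fun x : M ↦ TangentSpace I x))
    (h : cov.ContMDiffCovariantDerivative ∞) (f : M → ℝ) (hf : CMDiff ∞ f)
    (X Y : SmoothVectorField I M) :
    covDeriv cov h (smulFun f hf X) Y = smulFun f hf (covDeriv cov h X Y) := by
  ext x
  simp

/-- The derivative `X f` of a function along a vector field. -/
def dirDeriv (f : M → ℝ) (X : SmoothVectorField I M) (x : M) : ℝ := d% f x (X x)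

theorem dirDeriv_sub (f : M → ℝ) (X Y : SmoothVectorField I M) (x : M) :
    dirDeriv f (X - Y) x = dirDeriv f X x - dirDeriv f Y x := by
  simp [dirDeriv]

theorem contMDiff_dirDeriv {f : M → ℝ} (hf : CMDiff ∞ f) (X : SmoothVectorField I M) :
    CMDiff ∞ (dirDeriv f X) := by
  have h := (hf.contMDiff_tangentMap (m := ∞) (by simp)).comp X.contMDiff
  exact contMDiff_snd_tangentBundle_modelSpace ℝ 𝓘(ℝ, ℝ) |>.comp h

theorem covDeriv_smulFun_right (cov : CovariantDerivative I E (fun x : M ↦ TangentSpace I x))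
    (h : cov.ContMDiffCovariantDerivative ∞) {f : M → ℝ} (hf : CMDiff ∞ f)
    (X Y : SmoothVectorField I M) :
    covDeriv cov h X (smulFun f hf Y) =
      smulFun f hf (covDeriv cov h X Y) + smulFun _ (contMDiff_dirDeriv hf X) Y := by
  ext x
  have := cov.isCovariantDerivativeOnUniv.leibniz (Y.mdiffAt x)
    (hf.mdifferentiable (by simp) x)
  exact congrArg (fun F ↦ F (X x)) this

end SmoothVectorField

theorem CovariantDerivative.congr_of_eventuallyEq
    (cov : CovariantDerivative I E (fun x : M ↦ TangentSpace I x))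
    {X Y : Π x : M, TangentSpace I x} {x : M} (hX : MDiffAt (T% X) x) (hY : MDiffAt (T% Y) x)
    (h : ∀ᶠ y in 𝓝 x, X y = Y y) : cov X x = cov Y x :=
  cov.isCovariantDerivativeOnUniv.congr_of_eventuallyEq hX hY Filter.univ_mem h

namespace SmoothVectorField

theorem mdiffAt_of_eventuallyEq (X : SmoothVectorField I M)
    {σ : Π y : M, TangentSpace I y} {x : M} (h : ∀ᶠ y in 𝓝 x, σ y = X y) :
    MDiffAt (T% σ) x :=
  (X.mdiffAt x).congr_of_eventuallyEq (h.mono fun y hy ↦ by simp [hy])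

theorem cov_apply_eventuallyEq
    (cov : CovariantDerivative I E (fun x : M ↦ TangentSpace I x)) (X Y : SmoothVectorField I M)
    {σ τ : Π y : M, TangentSpace I y} {x : M} (hσ : ∀ᶠ y in 𝓝 x, σ y = X y)
    (hτ : ∀ᶠ y in 𝓝 x, τ y = Y y) : ∀ᶠ y in 𝓝 x, cov τ y (σ y) = cov Y y (X y) := by
  filter_upwards [hσ, hτ.eventually_nhds] with y hy hy'
  rw [hy, cov.congr_of_eventuallyEq (Y.mdiffAt_of_eventuallyEq hy') (Y.mdiffAt y) hy']

variable [FiniteDimensional ℝ E]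

/-- The Lie bracket of smooth vector fields. -/
def lieBracket (X Y : SmoothVectorField I M) : SmoothVectorField I M :=
  ⟨mlieBracket I X Y, by
    have : IsManifold I (minSmoothness ℝ 2) M := by
      simpa using IsManifold.of_le (I := I) (M := M) (m := 2) (n := ∞) ENat.LEInfty.out
    have : IsManifold I (((⊤ : ℕ∞) : ℕ∞ω) + 1) M := by simpa using ‹IsManifold I ∞ M›
    exact ContDiff.mlieBracket_vectorField (m := ⊤) (n := ⊤) X.contMDiff Y.contMDiff (by simp)⟩

@[simp]
theorem lieBracket_apply (X Y : SmoothVectorField I M) (x : M) :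
    lieBracket X Y x = mlieBracket I X Y x := rfl

theorem lieBracket_jacobi (X Y Z : SmoothVectorField I M) :
    lieBracket X (lieBracket Y Z) = lieBracket (lieBracket X Y) Z + lieBracket Y (lieBracket X Z) := by
  have : IsManifold I (minSmoothness ℝ 3) M := by
    simpa using IsManifold.of_le (I := I) (M := M) (m := 3) (n := ∞) ENat.LEInfty.out
  ext x
  have h (W : SmoothVectorField I M) : CMDiffAt (minSmoothness ℝ 2) (T% fun y ↦ W y) x :=
    W.contMDiff.contMDiffAt.of_le (by simpa using ENat.LEInfty.out)
  exact leibniz_identity_mlieBracket_apply (h X) (h Y) (h Z)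

/-- The torsion of a smooth connection as a bilinear map on smooth vector fields. -/
def torsion (cov : CovariantDerivative I E (fun x : M ↦ TangentSpace I x))
    (h : cov.ContMDiffCovariantDerivative ∞) :
    SmoothVectorField I M →ₗ[ℝ] SmoothVectorField I M →ₗ[ℝ] SmoothVectorField I M :=
  LinearMap.mk₂ ℝ
    (fun X Y ↦ ⟨fun x ↦ cov.torsion x (X x) (Y x), by
      convert (covDeriv cov h X Y - covDeriv cov h Y X - lieBracket X Y).contMDiff using 3 with x
      exact cov.torsion_apply (X.mdiffAt x) (Y.mdiffAt x)⟩)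
    (by intros; ext; simp)
    (by intros; ext; simp)
    (by intros; ext; simp)
    (by intros; ext; simp)

@[simp]
theorem torsion_apply (cov : CovariantDerivative I E (fun x : M ↦ TangentSpace I x))
    (h : cov.ContMDiffCovariantDerivative ∞) (X Y : SmoothVectorField I M) (x : M) :
    torsion cov h X Y x = cov.torsion x (X x) (Y x) := rfl

theorem lieBracket_eq_sub_torsion (cov : CovariantDerivative I E (fun x : M ↦ TangentSpace I x))
    (h : cov.ContMDiffCovariantDerivative ∞) (X Y : SmoothVectorField I M) :
    lieBracket X Y = covDeriv cov h X Y - covDeriv cov h Y X - torsion cov h X Y := by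
  ext x
  have := cov.torsion_apply (X.mdiffAt x) (Y.mdiffAt x)
  simp [this]

theorem torsion_swap (cov : CovariantDerivative I E (fun x : M ↦ TangentSpace I x))
    (h : cov.ContMDiffCovariantDerivative ∞) (X Y : SmoothVectorField I M) :
    torsion cov h X Y = - torsion cov h Y X := by
  ext x
  exact cov.torsion_antisymm ..

/-- Every vector field that is smooth near `x` has the same germ at `x` as a globally smooth one. -/
theorem exists_eventuallyEq [T2Space M] {x : M} {σ : Π y : M, TangentSpace I y} {s : Set M}
    (hs : s ∈ 𝓝 x) (hσ : CMDiff[s] ∞ (T% σ)) :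
    ∃ X : SmoothVectorField I M, ∀ᶠ y in 𝓝 x, X y = σ y := by
  obtain ⟨f, hf⟩ :=
    (SmoothBumpFunction.nhds_basis_support (I := I) (interior_mem_nhds.mpr hs)).ex_mem
  have := ContMDiffOn.smul_section_of_tsupport (f.contMDiff.contMDiffOn) isOpen_interior hf
    (hσ.mono interior_subset)
  refine ⟨⟨_, this⟩, ?_⟩
  filter_upwards [f.eventuallyEq_one] with y hy
  simp [hy]

/-- An operation on smooth vector fields that is linear over the smooth functions depends only on
the value of the field at the point. (Mathlib's `TensorialAt` asks for the linearity on all fields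
that are differentiable at the point, and curvature is not of this kind.) -/
theorem eq_zero_of_smulFun [T2Space M] {A : Type*} [AddCommGroup A] [Module ℝ A] {x : M}
    (Φ : SmoothVectorField I M →+ A)
    (hΦ : ∀ f hf X, Φ (smulFun f hf X) = f x • Φ X) {X : SmoothVectorField I M} (hX : X x = 0) :
    Φ X = 0 := by
  let t := trivializationAt E (fun x : M ↦ TangentSpace I x) x
  have hx : x ∈ t.baseSet := FiberBundle.mem_baseSet_trivializationAt E _ x
  let b := Module.finBasis ℝ E
  obtain ⟨f, hf⟩ := (SmoothBumpFunction.nhds_basis_support (I := I)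
    (t.open_baseSet.mem_nhds hx)).ex_mem
  let e (i) : SmoothVectorField I M := ⟨_, ContMDiffOn.smul_section_of_tsupport
    f.contMDiff.contMDiffOn t.open_baseSet hf (t.contMDiffOn_localFrame_baseSet ∞ b i)⟩
  have hc (i) : CMDiff ∞ (fun y ↦ f y * t.localFrameCoeff I b i y (X y)) := by
    refine contMDiff_of_tsupport fun y hy ↦ ?_
    have hy' : y ∈ t.baseSet := hf (closure_mono (Function.support_mul_subset_left _ _) hy)
    exact f.contMDiffAt.mul (contMDiffAt_localFrameCoeff b hy' X.contMDiff.contMDiffAt i)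
  -- Cutting off twice, once for the coefficients and once for the frame, makes both global.
  have key : smulFun (fun y ↦ f y * f y) (f.contMDiff.mul f.contMDiff) X =
      ∑ i, smulFun _ (hc i) (e i) := by
    ext y
    have hsum : (∑ i, smulFun _ (hc i) (e i)) y = ∑ i, smulFun _ (hc i) (e i) y := by
      rw [← ContMDiffSection.coeAddHom_apply, map_sum, Finset.sum_apply]
      rfl
    rw [hsum]
    by_cases hy : y ∈ t.baseSet
    · conv_lhs => rw [smulFun_apply, t.eq_sum_localFrameCoeff_smul (I := I) (b := b) (s := X) hy]
      rw [Finset.smul_sum]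
      refine Finset.sum_congr rfl fun i _ ↦ ?_
      simp [e, smul_smul]
      ring_nf
    · have hfy : f y = 0 := image_eq_zero_of_notMem_tsupport fun h ↦ hy (hf h)
      simp [hfy]
  have := congrArg Φ key
  simpa [hΦ, hX, f.eq_one] using this

/-! ### The curvature is a tensor -/

theorem torsion_smulFun_left (cov : CovariantDerivative I E (fun x : M ↦ TangentSpace I x))
    (h : cov.ContMDiffCovariantDerivative ∞) (f : M → ℝ) (hf : CMDiff ∞ f)
    (X Y : SmoothVectorField I M) :
    torsion cov h (smulFun f hf X) Y = smulFun f hf (torsion cov h X Y) := by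
  ext x
  simp

theorem torsion_smulFun_right (cov : CovariantDerivative I E (fun x : M ↦ TangentSpace I x))
    (h : cov.ContMDiffCovariantDerivative ∞) (f : M → ℝ) (hf : CMDiff ∞ f)
    (X Y : SmoothVectorField I M) :
    torsion cov h X (smulFun f hf Y) = smulFun f hf (torsion cov h X Y) := by
  ext x
  simp

/-- The commutator identity `[X, Y] f = X (Y f) - Y (X f)`, multiplied by a field `Z`.
It is the Jacobi identity for the fields `X`, `Y` and `f • Z`. -/
theorem dirDeriv_lieBracket_smul (cov : CovariantDerivative I E (fun x : M ↦ TangentSpace I x))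
    (h : cov.ContMDiffCovariantDerivative ∞) {f : M → ℝ} (hf : CMDiff ∞ f)
    (X Y Z : SmoothVectorField I M) (x : M) :
    dirDeriv f (lieBracket X Y) x • Z x =
      (dirDeriv (dirDeriv f Y) X x - dirDeriv (dirDeriv f X) Y x) • Z x := by
  have h1 := congrArg (fun F ↦ F x) (lieBracket_jacobi X Y (smulFun f hf Z))
  have h2 := congrArg (fun F ↦ F x) (lieBracket_jacobi X Y Z)
  simp only [lieBracket_eq_sub_torsion cov h, map_sub, map_add, LinearMap.sub_apply, LinearMap.add_apply,
    covDeriv_smulFun_left, covDeriv_smulFun_right, torsion_smulFun_right,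
    ContMDiffSection.coe_sub, ContMDiffSection.coe_add, Pi.sub_apply, Pi.add_apply,
    smulFun_apply, dirDeriv_sub] at h1 h2 ⊢
  linear_combination (norm := module) f x • h2 - h1

/-- The curvature `R(X, Y) Z` of a smooth connection, as a smooth vector field. -/
def curvature (cov : CovariantDerivative I E (fun x : M ↦ TangentSpace I x))
    (h : cov.ContMDiffCovariantDerivative ∞) (X Y Z : SmoothVectorField I M) :
    SmoothVectorField I M :=
  covDeriv cov h X (covDeriv cov h Y Z) - covDeriv cov h Y (covDeriv cov h X Z) -
    covDeriv cov h (lieBracket X Y) Z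

theorem curvature_smulFun_right (cov : CovariantDerivative I E (fun x : M ↦ TangentSpace I x))
    (h : cov.ContMDiffCovariantDerivative ∞) {f : M → ℝ} (hf : CMDiff ∞ f)
    (X Y Z : SmoothVectorField I M) (x : M) :
    curvature cov h X Y (smulFun f hf Z) x = f x • curvature cov h X Y Z x := by
  have h1 := dirDeriv_lieBracket_smul cov h hf X Y Z x
  simp only [curvature, map_add, covDeriv_smulFun_right, ContMDiffSection.coe_sub, ContMDiffSection.coe_add, Pi.sub_apply,
    Pi.add_apply, smulFun_apply]
  linear_combination (norm := module) - h1

theorem curvature_smulFun_left (cov : CovariantDerivative I E (fun x : M ↦ TangentSpace I x))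
    (h : cov.ContMDiffCovariantDerivative ∞) {f : M → ℝ} (hf : CMDiff ∞ f)
    (X Y Z : SmoothVectorField I M) (x : M) :
    curvature cov h (smulFun f hf X) Y Z x = f x • curvature cov h X Y Z x := by
  simp only [curvature, lieBracket_eq_sub_torsion cov h, map_sub, map_add, LinearMap.sub_apply,
    LinearMap.add_apply, covDeriv_smulFun_left, covDeriv_smulFun_right, torsion_smulFun_left,
    ContMDiffSection.coe_sub, ContMDiffSection.coe_add, Pi.sub_apply, Pi.add_apply, smulFun_apply]
  module

theorem curvature_add_left (cov : CovariantDerivative I E (fun x : M ↦ TangentSpace I x))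
    (h : cov.ContMDiffCovariantDerivative ∞) (X X' Y Z : SmoothVectorField I M) :
    curvature cov h (X + X') Y Z = curvature cov h X Y Z + curvature cov h X' Y Z := by
  simp only [curvature, lieBracket_eq_sub_torsion cov h, map_sub, map_add, LinearMap.sub_apply,
    LinearMap.add_apply]
  abel

theorem curvature_add_right (cov : CovariantDerivative I E (fun x : M ↦ TangentSpace I x))
    (h : cov.ContMDiffCovariantDerivative ∞) (X Y Z Z' : SmoothVectorField I M) :
    curvature cov h X Y (Z + Z') = curvature cov h X Y Z + curvature cov h X Y Z' := by
  simp only [curvature, map_add]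
  abel

theorem curvature_swap (cov : CovariantDerivative I E (fun x : M ↦ TangentSpace I x))
    (h : cov.ContMDiffCovariantDerivative ∞) (X Y Z : SmoothVectorField I M) :
    curvature cov h X Y Z = - curvature cov h Y X Z := by
  simp only [curvature, lieBracket_eq_sub_torsion cov h, map_sub, LinearMap.sub_apply, torsion_swap cov h Y X,
    map_neg, LinearMap.neg_apply]
  abel

/-- The value `R(X, Y) Z` of the curvature at `x` depends only on the values of the smooth fields
`X`, `Y`, `Z` at `x`. -/
theorem curvature_congr [T2Space M] (cov : CovariantDerivative I E (fun x : M ↦ TangentSpace I x))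
    (h : cov.ContMDiffCovariantDerivative ∞) {X Y Z X' Y' Z' : SmoothVectorField I M} {x : M}
    (hX : X x = X' x) (hY : Y x = Y' x) (hZ : Z x = Z' x) :
    curvature cov h X Y Z x = curvature cov h X' Y' Z' x := by
  have left (X X' Y Z : SmoothVectorField I M) (hX : X x = X' x) :
      curvature cov h X Y Z x = curvature cov h X' Y Z x := by
    let Φ : SmoothVectorField I M →+ TangentSpace I x :=
      AddMonoidHom.mk' (fun X ↦ curvature cov h X Y Z x) (by simp [curvature_add_left])
    have := eq_zero_of_smulFun Φ (fun f hf X ↦ curvature_smulFun_left cov h hf X Y Z x)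
      (X := X - X') (by simp [hX])
    exact sub_eq_zero.mp ((map_sub Φ X X').symm.trans this)
  have right (X Y Z Z' : SmoothVectorField I M) (hZ : Z x = Z' x) :
      curvature cov h X Y Z x = curvature cov h X Y Z' x := by
    let Φ : SmoothVectorField I M →+ TangentSpace I x :=
      AddMonoidHom.mk' (fun Z ↦ curvature cov h X Y Z x) (by simp [curvature_add_right])
    have := eq_zero_of_smulFun Φ (fun f hf Z ↦ curvature_smulFun_right cov h hf X Y Z x)
      (X := Z - Z') (by simp [hZ])
    exact sub_eq_zero.mp ((map_sub Φ Z Z').symm.trans this)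
  calc curvature cov h X Y Z x = curvature cov h X' Y Z x := left _ _ _ _ hX
    _ = (- curvature cov h Y X' Z : SmoothVectorField I M) x := by rw [← curvature_swap]
    _ = (- curvature cov h Y' X' Z : SmoothVectorField I M) x := by
      simp [left _ _ X' Z hY]
    _ = curvature cov h X' Y' Z x := by rw [← curvature_swap]
    _ = curvature cov h X' Y' Z' x := right _ _ _ _ hZ

theorem exists_eventuallyEq_extend [T2Space M] {x : M} (u : TangentSpace I x) :
    ∃ X : SmoothVectorField I M, ∀ᶠ y in 𝓝 x, X y = extend E u y := by
  obtain ⟨s, hs, h⟩ := exists_contMDiffOn_extend (k := ∞) I E u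
  exact exists_eventuallyEq hs h

theorem exists_apply_eq_at [T2Space M] {x : M} (u : TangentSpace I x) :
    ∃ X : SmoothVectorField I M, X x = u := by
  obtain ⟨X, hX⟩ := exists_eventuallyEq_extend u
  exact ⟨X, by simpa using hX.self_of_nhds⟩

end SmoothVectorField

open SmoothVectorField

variable [FiniteDimensional ℝ E]

/-- At `x`, the curvature of vector fields depends only on their germs. The covariant derivative
is only required to send smooth fields to smooth fields, which is what `G` encodes. -/
theorem curvatureField_congr (cov : CovariantDerivative I E (fun x : M ↦ TangentSpace I x))
    {G : SmoothVectorField I M → SmoothVectorField I M → SmoothVectorField I M}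
    (hG : ∀ X Y x, G X Y x = cov Y x (X x)) (X Y Z : SmoothVectorField I M)
    {ρ σ τ : Π y : M, TangentSpace I y} {x : M} (hρ : ∀ᶠ y in 𝓝 x, ρ y = X y)
    (hσ : ∀ᶠ y in 𝓝 x, σ y = Y y) (hτ : ∀ᶠ y in 𝓝 x, τ y = Z y) :
    curvatureField cov ρ σ τ x = (G X (G Y Z) - G Y (G X Z) - G (lieBracket X Y) Z) x := by
  have h1 := (cov_apply_eventuallyEq cov X (G Y Z) hρ
    ((cov_apply_eventuallyEq cov Y Z hσ hτ).mono fun y hy ↦ hy.trans (hG ..).symm)).self_of_nhds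
  have h2 := (cov_apply_eventuallyEq cov Y (G X Z) hσ
    ((cov_apply_eventuallyEq cov X Z hρ hτ).mono fun y hy ↦ hy.trans (hG ..).symm)).self_of_nhds
  have h3 : mlieBracket I ρ σ x = lieBracket X Y x :=
    Filter.EventuallyEq.mlieBracket_vectorField_eq hρ hσ
  have h4 := cov.congr_of_eventuallyEq (Z.mdiffAt_of_eventuallyEq hτ) (Z.mdiffAt x) hτ
  rw [curvatureField, h1, h2, h3, h4]
  simp [hG]

/-- The curvature tensor at a point is computed by globally smooth fields with the prescribed values
there, namely by fields with the germs of the extensions used in its definition. -/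
theorem exists_curvatureTensor_eq [T2Space M]
    (cov : CovariantDerivative I E (fun x : M ↦ TangentSpace I x))
    {G : SmoothVectorField I M → SmoothVectorField I M → SmoothVectorField I M}
    (hG : ∀ X Y x, G X Y x = cov Y x (X x)) {x : M} (u v w : TangentSpace I x) :
    ∃ X Y Z : SmoothVectorField I M, X x = u ∧ Y x = v ∧ Z x = w ∧
      curvatureTensor cov x u v w = (G X (G Y Z) - G Y (G X Z) - G (lieBracket X Y) Z) x := by
  obtain ⟨X, hX⟩ := exists_eventuallyEq_extend u
  obtain ⟨Y, hY⟩ := exists_eventuallyEq_extend v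
  obtain ⟨Z, hZ⟩ := exists_eventuallyEq_extend w
  exact ⟨X, Y, Z, by simpa using hX.self_of_nhds, by simpa using hY.self_of_nhds,
    by simpa using hZ.self_of_nhds, curvatureField_congr cov hG X Y Z (hX.mono fun _ h ↦ h.symm)
    (hY.mono fun _ h ↦ h.symm) (hZ.mono fun _ h ↦ h.symm)⟩

/-- The curvature of a flat smooth connection vanishes on all smooth fields, and not only on the
extensions used in the definition of `curvatureTensor`. -/
theorem IsFlatConnection.covDeriv_comm [T2Space M]
    {cov : CovariantDerivative I E (fun x : M ↦ TangentSpace I x)} (hflat : IsFlatConnection cov)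
    (h : cov.ContMDiffCovariantDerivative ∞) (X Y Z : SmoothVectorField I M) :
    covDeriv cov h X (covDeriv cov h Y Z) - covDeriv cov h Y (covDeriv cov h X Z) -
      covDeriv cov h (covDeriv cov h X Y - covDeriv cov h Y X - torsion cov h X Y) Z = 0 := by
  rw [← lieBracket_eq_sub_torsion]
  ext x
  obtain ⟨X', Y', Z', hX, hY, hZ, h'⟩ :=
    exists_curvatureTensor_eq cov (covDeriv_apply cov h) (X x) (Y x) (Z x)
  rw [hflat] at h'
  exact (curvature_congr cov h hX.symm hY.symm hZ.symm).trans h'.symm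

/-- At a point where four vector fields are parallel, the coefficient of a parallel tensor on them
has vanishing differential. -/
theorem IsParallelTensor.hasMFDerivAt_zero [T2Space M]
    {cov : CovariantDerivative I E (fun x : M ↦ TangentSpace I x)}
    {S : Π x : M, TangentSpace I x → TangentSpace I x → TangentSpace I x → TangentSpace I x → ℝ}
    (hS : IsParallelTensor cov S) {X Y Z W : Π x : M, TangentSpace I x} {U : Set M} {x : M}
    (h0 : ∀ u v w, S x 0 u v w = 0 ∧ S x u 0 v w = 0 ∧ S x u v 0 w = 0 ∧ S x u v w 0 = 0)
    (hU : U ∈ 𝓝 x) (hX : CMDiff[U] ∞ (T% X)) (hY : CMDiff[U] ∞ (T% Y)) (hZ : CMDiff[U] ∞ (T% Z))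
    (hW : CMDiff[U] ∞ (T% W)) (hX' : cov X x = 0) (hY' : cov Y x = 0) (hZ' : cov Z x = 0)
    (hW' : cov W x = 0) :
    HasMFDerivAt I 𝓘(ℝ, ℝ) (fun y ↦ S y (X y) (Y y) (Z y) (W y)) x 0 := by
  -- Replace the fields by global ones with the same germs at `x`.
  have global {X : Π x : M, TangentSpace I x} (hX : CMDiff[U] ∞ (T% X)) (hX' : cov X x = 0) :
      ∃ X₁ : SmoothVectorField I M, (∀ᶠ y in 𝓝 x, X₁ y = X y) ∧ cov X₁ x = 0 := by
    obtain ⟨X₁, h⟩ := exists_eventuallyEq hU hX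
    exact ⟨X₁, h, (cov.congr_of_eventuallyEq (X₁.mdiffAt x)
      ((hX.contMDiffAt hU).mdifferentiableAt (by simp)) h).trans hX'⟩
  obtain ⟨X₁, eX, dX⟩ := global hX hX'
  obtain ⟨Y₁, eY, dY⟩ := global hY hY'
  obtain ⟨Z₁, eZ, dZ⟩ := global hZ hZ'
  obtain ⟨W₁, eW, dW⟩ := global hW hW'
  obtain ⟨hsm, hpar⟩ := hS X₁ Y₁ Z₁ W₁ X₁.contMDiff Y₁.contMDiff Z₁.contMDiff W₁.contMDiff
  have hd := (hsm.mdifferentiable (by simp) x).hasMFDerivAt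
  have hz : mfderiv I 𝓘(ℝ, ℝ) (fun y ↦ S y (X₁ y) (Y₁ y) (Z₁ y) (W₁ y)) x = 0 := by
    ext v
    have := hpar x v
    simp only [covDerivTensor, dX, dY, dZ, dW, zero_apply, (h0 _ _ _).1, (h0 _ _ _).2.1,
      (h0 _ _ _).2.2.1, (h0 _ _ _).2.2.2, sub_zero] at this
    exact this
  rw [hz] at hd
  refine hd.congr_of_eventuallyEq ?_
  filter_upwards [eX, eY, eZ, eW] with y h1 h2 h3 h4
  rw [h1, h2, h3, h4]

end Fields

/-! ### Metric connections with skew torsion -/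

/-- A tensor `n` that is skew in its last three arguments, and whose cyclic sum over the first three
arguments is a `4`-form `φ`, is `φ / 3`. -/
theorem three_mul_eq_of_cyclic_sum {α : Type*} {n φ : α → α → α → α → ℝ}
    (h₁ : ∀ X Y Z V, n X Y Z V = -n X Z Y V) (h₂ : ∀ X Y Z V, n X Y Z V = -n X Y V Z)
    (hφ : ∀ X Y Z V, φ X Y Z V = -φ X Y V Z)
    (h : ∀ X Y Z V, n X Y Z V + n Y Z X V + n Z X Y V = φ X Y Z V) (X Y Z V : α) :
    3 * n X Y Z V = φ X Y Z V := by
  have a1 := h₁ X Y Z V; have a2 := h₁ X Y V Z; have a3 := h₁ X Z V Y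
  have a4 := h₂ X Y Z V; have a5 := h₂ X Z Y V; have a6 := h₂ X V Y Z
  have b1 := h₁ Y X Z V; have b2 := h₁ Y X V Z; have b3 := h₁ Y Z V X
  have b4 := h₂ Y X Z V; have b5 := h₂ Y Z X V; have b6 := h₂ Y V X Z
  have c1 := h₁ Z X Y V; have c2 := h₁ Z X V Y; have c3 := h₁ Z Y V X
  have c4 := h₂ Z X Y V; have c5 := h₂ Z Y X V; have c6 := h₂ Z V X Y
  have d1 := h₁ V X Y Z; have d2 := h₁ V X Z Y; have d3 := h₁ V Y Z X
  have d4 := h₂ V X Y Z; have d5 := h₂ V Y X Z; have d6 := h₂ V Z X Y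
  have e1 := h X Y Z V; have e2 := h X Y V Z; have e3 := h Y Z V X; have e4 := h X Z V Y
  have f1 := hφ X Y Z V; have f2 := hφ Y Z X V; have f3 := hφ X Z Y V
  have e5 := h Y Z X V; have e6 := h X Z Y V
  linarith

noncomputable section Metric

variable {E : Type*} [NormedAddCommGroup E] [NormedSpace ℝ E] [FiniteDimensional ℝ E]
  {H : Type*} [TopologicalSpace H] {I : ModelWithCorners ℝ E H}
  {M : Type*} [TopologicalSpace M] [ChartedSpace H M] [IsManifold I ∞ M]
  [RiemannianBundle (fun (x : M) ↦ TangentSpace I x)]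
  {cov : CovariantDerivative I E (fun x : M ↦ TangentSpace I x)}

open SmoothVectorField

/-- For a metric connection with skew torsion, `(∇_X T)(Y, Z, V)` is skew in `Z` and `V`. -/
theorem inner_covDeriv_torsion_skew (hmetric : IsMetricConnection cov)
    (hskew : HasSkewTorsion cov) (h : cov.ContMDiffCovariantDerivative ∞)
    (X Y Z V : SmoothVectorField I M) (x : M) :
    inner ℝ ((covDeriv cov h X (torsion cov h Y Z) - torsion cov h (covDeriv cov h X Y) Z -
      torsion cov h Y (covDeriv cov h X Z)) x) (V x) =
    - inner ℝ ((covDeriv cov h X (torsion cov h Y V) - torsion cov h (covDeriv cov h X Y) V -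
      torsion cov h Y (covDeriv cov h X V)) x) (Z x) := by
  have h1 := hmetric x (X x) (torsion cov h Y Z) V (mdiffAt _ x) (mdiffAt _ x)
  have h2 := hmetric x (X x) (torsion cov h Y V) Z (mdiffAt _ x) (mdiffAt _ x)
  have h3 : (fun y ↦ inner ℝ (torsion cov h Y Z y) (V y)) =
      -(fun y ↦ inner ℝ (torsion cov h Y V y) (Z y)) := by
    ext y
    exact (hskew y _ _ _).2
  rw [h3, mvfderiv_neg, neg_apply, h2] at h1
  simp only [ContMDiffSection.coe_sub, Pi.sub_apply, inner_sub_left, covDeriv_apply, torsion_apply]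
    at h1 ⊢
  have s1 := (hskew x (cov Y x (X x)) (Z x) (V x)).2
  have s2 := (hskew x (Y x) (cov Z x (X x)) (V x)).2
  have s3 := (hskew x (Y x) (cov V x (X x)) (Z x)).2
  linarith

/-- For a flat metric connection with skew torsion, `∇_X T = (1/3) A_X ⋅ T`, where the skew
endomorphism `A_X = T(X, ⋅)` acts as a derivation. Since `∇_X T` is skew in its last three arguments,
it is determined by its cyclic sum, which the first Bianchi identity expresses through `T`. -/
theorem covDeriv_torsion [T2Space M] (hmetric : IsMetricConnection cov)
    (hskew : HasSkewTorsion cov) (hflat : IsFlatConnection cov)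
    (h : cov.ContMDiffCovariantDerivative ∞) (X Y Z : SmoothVectorField I M) :
    covDeriv cov h X (torsion cov h Y Z) =
      torsion cov h (covDeriv cov h X Y) Z + torsion cov h Y (covDeriv cov h X Z) +
      (1 / 3 : ℝ) • (torsion cov h X (torsion cov h Y Z) - torsion cov h (torsion cov h X Y) Z -
        torsion cov h Y (torsion cov h X Z)) := by
  ext x
  refine ext_inner_right ℝ fun v ↦ ?_
  obtain ⟨V, rfl⟩ := exists_apply_eq_at v
  have key := three_mul_eq_of_cyclic_sum
    (n := fun X Y Z V : SmoothVectorField I M ↦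
      inner ℝ ((covDeriv cov h X (torsion cov h Y Z) - torsion cov h (covDeriv cov h X Y) Z -
      torsion cov h Y (covDeriv cov h X Z)) x) (V x))
    (φ := fun X Y Z V ↦ inner ℝ ((-(torsion cov h (torsion cov h X Y) Z +
      torsion cov h (torsion cov h Y Z) X + torsion cov h (torsion cov h Z X) Y)) x) (V x))
    ?_ (fun _ _ _ _ ↦ inner_covDeriv_torsion_skew hmetric hskew h ..) ?_ ?_ X Y Z V
  · have s1 := torsion_swap cov h X (torsion cov h Y Z)
    have s2 := torsion_swap cov h Y (torsion cov h Z X)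
    have s3 := torsion_swap cov h X Z
    simp only [s1, s2, s3, map_neg, ContMDiffSection.coe_sub, ContMDiffSection.coe_neg,
      ContMDiffSection.coe_add, ContMDiffSection.coe_smul, Pi.sub_apply, Pi.add_apply, Pi.neg_apply,
      Pi.smul_apply, inner_sub_left, inner_add_left, inner_neg_left, inner_smul_left,
      RCLike.conj_to_real] at key ⊢
    linarith
  · intro X Y Z V
    rw [← inner_neg_left, ← Pi.neg_apply, ← ContMDiffSection.coe_neg]
    congr 2
    rw [torsion_swap cov h Z Y, torsion_swap cov h (covDeriv cov h X Z) Y,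
      torsion_swap cov h Z (covDeriv cov h X Y), map_neg]
    abel_nf
  · intro X Y Z V
    simp only [ContMDiffSection.coe_neg, ContMDiffSection.coe_add, Pi.neg_apply, Pi.add_apply,
      inner_neg_left, inner_add_left, torsion_apply]
    have s1 := (hskew x (cov.torsion x (X x) (Y x)) (Z x) (V x)).2
    -- `g(T(T(p, q), r), s) = g(T(p, q), T(r, s))`
    have s2 (p q r s : TangentSpace I x) : inner ℝ (cov.torsion x (cov.torsion x p q) r) s =
        inner ℝ (cov.torsion x p q) (cov.torsion x r s) := by
      rw [(hskew x _ r s).1, (hskew x r _ s).2, neg_neg, real_inner_comm]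
    simp only [s2, cov.torsion_antisymm (V x) (X x), cov.torsion_antisymm (Z x) (X x),
      map_neg, neg_apply, inner_neg_left] at s1 ⊢
    have c1 := real_inner_comm (cov.torsion x (Y x) (Z x)) (cov.torsion x (X x) (V x))
    have c2 := real_inner_comm (cov.torsion x (Y x) (V x)) (cov.torsion x (X x) (Z x))
    linarith
  · intro X Y Z V
    have hb := bianchi_of_flat (torsion_swap cov h) (hflat.covDeriv_comm h)
      (lieBracket_eq_sub_torsion cov h) lieBracket_jacobi X Y Z
    simpa only [ContMDiffSection.coe_add, Pi.add_apply, inner_add_left] using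
      congrArg (fun F : SmoothVectorField I M ↦ inner ℝ (F x) (V x)) hb

variable [IsContMDiffRiemannianBundle I ∞ E (fun (x : M) ↦ TangentSpace I x)]

/-- A metric connection with skew torsion differs from the Levi-Civita connection by half of its
torsion: `∇^g_u Y = ∇_u Y - T(u, Y) / 2`. -/
theorem leviCivita_apply_eq (hmetric : IsMetricConnection cov) (hskew : HasSkewTorsion cov)
    {Y : Π x : M, TangentSpace I x} {x : M} (hY : MDiffAt (T% Y) x) (u : TangentSpace I x) :
    leviCivita I Y x u = cov Y x u - (1 / 2 : ℝ) • cov.torsion x u (Y x) := by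
  refine ext_inner_right ℝ fun v ↦ ?_
  have hX := mdifferentiableAt_extend I E u
  have hZ := mdifferentiableAt_extend I E v
  have h := inner_leviCivita I hX hY hZ
  have t1 := cov.torsion_apply hX hY
  have t2 := cov.torsion_apply hX hZ
  have t3 := cov.torsion_apply hY hZ
  rw [eq_sub_iff_add_eq, ← eq_sub_iff_add_eq'] at t1 t2 t3
  rw [koszul, hmetric _ _ _ _ hY hZ, hmetric _ _ _ _ hX hZ, hmetric _ _ _ _ hX hY, t1, t2, t3] at h
  simp only [extend_apply_self] at h
  rw [h]
  simp only [inner_sub_left, inner_smul_left, RCLike.conj_to_real]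
  have s1 := (hskew x u (Y x) v).2
  have s2 := (hskew x u v (Y x)).1
  have s3 := (hskew x (Y x) v u).1
  have s4 := (hskew x v u (Y x)).2
  have c1 := real_inner_comm (cov Y x v) u
  have c2 := real_inner_comm (cov (extend E v) x u) (Y x)
  have c3 := real_inner_comm (cov (extend E v) x (Y x)) u
  have c4 := real_inner_comm (cov (extend E u) x v) (Y x)
  linarith

end Metric

/-! ### The Riemannian curvature tensor -/

noncomputable section Riemann

variable {E : Type*} [NormedAddCommGroup E] [NormedSpace ℝ E] [FiniteDimensional ℝ E]
  {H : Type*} [TopologicalSpace H] {I : ModelWithCorners ℝ E H}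
  {M : Type*} [TopologicalSpace M] [ChartedSpace H M] [IsManifold I ∞ M]
  [RiemannianBundle (fun (x : M) ↦ TangentSpace I x)]
  [IsContMDiffRiemannianBundle I ∞ E (fun (x : M) ↦ TangentSpace I x)]
  {cov : CovariantDerivative I E (fun x : M ↦ TangentSpace I x)}

open SmoothVectorField

/-- The Riemannian curvature is `-1/12` times the triple product of the torsion. -/
theorem riemannTensor_apply [T2Space M] (hmetric : IsMetricConnection cov)
    (hskew : HasSkewTorsion cov) (hflat : IsFlatConnection cov)
    (h : cov.ContMDiffCovariantDerivative ∞) (X Y Z : SmoothVectorField I M) (x : M)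
    (z : TangentSpace I x) :
    riemannTensor I x (X x) (Y x) (Z x) z =
      -(1 / 12 : ℝ) * inner ℝ (tripleProduct (torsion cov h) X Y Z x) z := by
  let G := covDeriv cov h - (1 / 2 : ℝ) • torsion cov h
  obtain ⟨X', Y', Z', hX, hY, hZ, hR⟩ := exists_curvatureTensor_eq (leviCivita I) (G := (G · ·))
    (fun X Y x ↦ (leviCivita_apply_eq hmetric hskew (Y.mdiffAt x) (X x)).symm) (X x) (Y x) (Z x)
  rw [riemannTensor, hR, lieBracket_eq_sub_torsion cov h,
    curvature_sub_half_smul (torsion_swap cov h) (hflat.covDeriv_comm h)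
      (covDeriv_torsion hmetric hskew hflat h) rfl, ContMDiffSection.coe_smul, Pi.smul_apply,
    inner_smul_left]
  simp [tripleProduct, hX, hY, hZ]

theorem torsion_tripleProduct [T2Space M] (hmetric : IsMetricConnection cov)
    (hskew : HasSkewTorsion cov) (hflat : IsFlatConnection cov)
    (h : cov.ContMDiffCovariantDerivative ∞) (X Y Z W : SmoothVectorField I M) :
    torsion cov h X (tripleProduct (torsion cov h) Y Z W) =
      tripleProduct (torsion cov h) (torsion cov h X Y) Z W +
      tripleProduct (torsion cov h) Y (torsion cov h X Z) W +
      tripleProduct (torsion cov h) Y Z (torsion cov h X W) :=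
  derivation_tripleProduct (torsion_swap cov h) (torsion_derivation (torsion_swap cov h)
    (hflat.covDeriv_comm h) (covDeriv_torsion hmetric hskew hflat h)) X Y Z W

theorem tensorBracket_torsion_riemannTensor [T2Space M] (hmetric : IsMetricConnection cov)
    (hskew : HasSkewTorsion cov) (hflat : IsFlatConnection cov)
    (h : cov.ContMDiffCovariantDerivative ∞) (x : M) (p u v w z : TangentSpace I x) :
    tensorBracket (cov.torsion x p) (riemannTensor I x) u v w z = 0 := by
  obtain ⟨P, rfl⟩ := exists_apply_eq_at p
  obtain ⟨X, rfl⟩ := exists_apply_eq_at u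
  obtain ⟨Y, rfl⟩ := exists_apply_eq_at v
  obtain ⟨Z, rfl⟩ := exists_apply_eq_at w
  have h1 := congrArg (fun F : SmoothVectorField I M ↦ inner ℝ (F x) z)
    (torsion_tripleProduct hmetric hskew hflat h P X Y Z)
  simp only [ContMDiffSection.coe_add, Pi.add_apply, inner_add_left] at h1
  rw [torsion_apply, (hskew ..).2, real_inner_comm] at h1
  simp only [tensorBracket, ← torsion_apply cov h, riemannTensor_apply hmetric hskew hflat h]
  linarith

/-- If a metric connection acts as a derivation on a trilinear operation `R` on vector fields, then
the tensor `c g(R(X, Y, Z), W)` is parallel. The map `G` is the connection as an operation on smooth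
fields. -/
theorem isParallelTensor_of_derivation (hmetric : IsMetricConnection cov)
    {G : SmoothVectorField I M → SmoothVectorField I M → SmoothVectorField I M}
    (hG : ∀ X Y x, G X Y x = cov Y x (X x))
    {R : SmoothVectorField I M → SmoothVectorField I M → SmoothVectorField I M →
      SmoothVectorField I M}
    (hR : ∀ X Y Z W, G X (R Y Z W) = R (G X Y) Z W + R Y (G X Z) W + R Y Z (G X W))
    {S : Π x : M, TangentSpace I x → TangentSpace I x → TangentSpace I x → TangentSpace I x → ℝ}
    {c : ℝ} (hS : ∀ (X Y Z W : SmoothVectorField I M) (x : M),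
      S x (X x) (Y x) (Z x) (W x) = c * inner ℝ (R X Y Z x) (W x)) [T2Space M] :
    IsParallelTensor cov S := by
  intro X Y Z W hX hY hZ hW
  obtain ⟨X, rfl⟩ : ∃ X' : SmoothVectorField I M, ⇑X' = X := ⟨⟨X, hX⟩, rfl⟩
  obtain ⟨Y, rfl⟩ : ∃ Y' : SmoothVectorField I M, ⇑Y' = Y := ⟨⟨Y, hY⟩, rfl⟩
  obtain ⟨Z, rfl⟩ : ∃ Z' : SmoothVectorField I M, ⇑Z' = Z := ⟨⟨Z, hZ⟩, rfl⟩
  obtain ⟨W, rfl⟩ : ∃ W' : SmoothVectorField I M, ⇑W' = W := ⟨⟨W, hW⟩, rfl⟩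
  have hin : CMDiff ∞ (fun y ↦ inner ℝ (R X Y Z y) (W y)) :=
    ContMDiff.inner_bundle (E := fun x : M ↦ TangentSpace I x) (F := E) (b := fun y ↦ y)
      (R X Y Z).contMDiff W.contMDiff
  simp only [hS]
  refine ⟨contMDiff_const.mul hin, fun x v ↦ ?_⟩
  obtain ⟨V, rfl⟩ := exists_apply_eq_at v
  have h1 := hmetric x (V x) (R X Y Z) W (mdiffAt _ x) (mdiffAt _ x)
  have h2 := congrArg (fun F : SmoothVectorField I M ↦ inner ℝ (F x) (W x)) (hR V X Y Z)
  have h3 := mvfderiv_fun_mul (mdifferentiableAt_const (c := c)) (hin.mdifferentiable (by simp) x)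
  simp only [ContMDiffSection.coe_add, Pi.add_apply, inner_add_left] at h2
  have h4 : d% (fun _ : M ↦ c) x = 0 := mvfderiv_const c
  simp only [covDerivTensor, hS, ← hG, h3, h4, smul_zero, add_zero, smul_apply, h1, h2, smul_eq_mul]
  ring

theorem isParallelTensor_riemannTensor [T2Space M] (hmetric : IsMetricConnection cov)
    (hskew : HasSkewTorsion cov) (hflat : IsFlatConnection cov)
    (h : cov.ContMDiffCovariantDerivative ∞) :
    IsParallelTensor cov (riemannTensor I) :=
  isParallelTensor_of_derivation hmetric (covDeriv_apply cov h)
    (covDeriv_tripleProduct (covDeriv_torsion hmetric hskew hflat h)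
      (torsion_tripleProduct hmetric hskew hflat h))
    fun X Y Z W x ↦ riemannTensor_apply hmetric hskew hflat h X Y Z x (W x)

theorem isParallelTensor_leviCivita_riemannTensor [T2Space M] (hmetric : IsMetricConnection cov)
    (hskew : HasSkewTorsion cov) (hflat : IsFlatConnection cov)
    (h : cov.ContMDiffCovariantDerivative ∞) :
    IsParallelTensor (leviCivita I) (riemannTensor I (M := M)) :=
  isParallelTensor_of_derivation leviCivita_isMetricConnection
    (G := ((covDeriv cov h - (1 / 2 : ℝ) • torsion cov h) · ·))
    (fun X Y x ↦ (leviCivita_apply_eq hmetric hskew (Y.mdiffAt x) (X x)).symm)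
    (sub_half_smul_tripleProduct
      (covDeriv_tripleProduct (covDeriv_torsion hmetric hskew hflat h)
        (torsion_tripleProduct hmetric hskew hflat h))
      (torsion_tripleProduct hmetric hskew hflat h) rfl)
    fun X Y Z W x ↦ riemannTensor_apply hmetric hskew hflat h X Y Z x (W x)

/-- A `∇`-parallel field `X` satisfies `∇^g_u X = -T(u, X) / 2`, which is skew in `u`. -/
theorem isKillingOn_of_parallel (hmetric : IsMetricConnection cov)
    (hskew : HasSkewTorsion cov) {X : Π x : M, TangentSpace I x} {U : Set M}
    (hX : ∀ x ∈ U, MDiffAt (T% X) x) (hpar : ∀ x ∈ U, cov X x = 0) : IsKillingOn X U := by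
  intro x hx u v
  have s1 := (hskew x u (X x) v).2
  have s2 := (hskew x u v (X x)).1
  have s3 := (hskew x v u (X x)).2
  have c := real_inner_comm (cov.torsion x v (X x)) u
  simp only [leviCivita_apply_eq hmetric hskew (hX x hx), hpar x hx, zero_apply, zero_sub,
    inner_neg_left, inner_neg_right, inner_smul_left, inner_smul_right, RCLike.conj_to_real]
  linarith

theorem riemannTensor_zero [T2Space M] (hmetric : IsMetricConnection cov)
    (hskew : HasSkewTorsion cov) (hflat : IsFlatConnection cov)
    (h : cov.ContMDiffCovariantDerivative ∞) (x : M) (u v w : TangentSpace I x) :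
    riemannTensor I x 0 u v w = 0 ∧ riemannTensor I x u 0 v w = 0 ∧
      riemannTensor I x u v 0 w = 0 ∧ riemannTensor I x u v w 0 = 0 := by
  obtain ⟨X, rfl⟩ := exists_apply_eq_at u
  obtain ⟨Y, rfl⟩ := exists_apply_eq_at v
  obtain ⟨Z, rfl⟩ := exists_apply_eq_at w
  have key := riemannTensor_apply hmetric hskew hflat h (x := x)
  have h1 := key 0 X Y (Z x)
  have h2 := key X 0 Y (Z x)
  have h3 := key X Y 0 (Z x)
  have h4 := key X Y Z 0
  simp only [ContMDiffSection.coe_zero, Pi.zero_apply] at h1 h2 h3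
  refine ⟨h1.trans ?_, h2.trans ?_, h3.trans ?_, h4.trans ?_⟩ <;> simp [tripleProduct]

end Riemann

/-- A function with zero derivative on a preconnected open set is constant there. -/
theorem IsPreconnected.eq_of_hasMFDerivAt_zero {E : Type*} [NormedAddCommGroup E] [NormedSpace ℝ E]
    {M : Type*} [TopologicalSpace M] [ChartedSpace E M] [IsManifold 𝓘(ℝ, E) ∞ M]
    {U : Set M} (hU : IsPreconnected U) (hU' : IsOpen U) {f : M → ℝ}
    (hf : ∀ x ∈ U, HasMFDerivAt 𝓘(ℝ, E) 𝓘(ℝ, ℝ) f x 0) {x y : M} (hx : x ∈ U) (hy : y ∈ U) :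
    f x = f y := by
  have hloc : ∀ x ∈ U, ∀ᶠ y in 𝓝 x, f y = f x := by
    intro x hx
    let e := chartAt E x
    let s := e.target ∩ e.symm ⁻¹' U
    have hs : IsOpen s := e.symm.isOpen_inter_preimage hU'
    have hd : ∀ z ∈ s, HasFDerivAt (f ∘ e.symm) (0 : E →L[ℝ] ℝ) z := by
      intro z hz
      have h1 := (mdifferentiableAt_atlas_symm (I := 𝓘(ℝ, E)) (chart_mem_atlas E x) hz.1).hasMFDerivAt
      have h2 := (hf _ hz.2).comp z h1
      rw [hasMFDerivAt_iff_hasFDerivAt] at h2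
      exact h2.congr_fderiv (ContinuousLinearMap.zero_comp _)
    have ho := hs.isOpen_inter_preimage_of_fderiv_eq_zero
      (fun z hz ↦ (hd z hz).differentiableAt.differentiableWithinAt)
      (fun z hz ↦ (hd z hz).fderiv) {f x}
    have hxe : x ∈ e.source := mem_chart_source E x
    have hm : e x ∈ s ∩ f ∘ e.symm ⁻¹' {f x} := by simp [s, hx, hxe]
    filter_upwards [(e.continuousAt hxe).preimage_mem_nhds (ho.mem_nhds hm),
      e.open_source.mem_nhds hxe] with y hy hye
    simpa [hye] using hy.2
  have : PreconnectedSpace U := isPreconnected_iff_preconnectedSpace.mp hU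
  have hl : IsLocallyConstant (U.domRestrict f) := by
    rw [IsLocallyConstant.iff_eventually_eq]
    rintro ⟨x, hx⟩
    exact (continuous_subtype_val.continuousAt (x := ⟨x, hx⟩)).eventually (hloc x hx)
  exact hl.apply_eq_of_preconnectedSpace ⟨x, hx⟩ ⟨y, hy⟩

theorem mainTheorem2
    {E : Type*} [NormedAddCommGroup E] [NormedSpace ℝ E] [FiniteDimensional ℝ E]
    {M : Type*} [MetricSpace M] [ChartedSpace E M] [IsManifold 𝓘(ℝ, E) ∞ M]
    [RiemannianBundle (fun (x : M) ↦ TangentSpace 𝓘(ℝ, E) x)]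
    [IsContMDiffRiemannianBundle 𝓘(ℝ, E) ∞ E (fun (x : M) ↦ TangentSpace 𝓘(ℝ, E) x)]
    [IsRiemannianManifold 𝓘(ℝ, E) M]
    [CompleteSpace M] [SimplyConnectedSpace M]
    (hirr : IsIrreducibleRiemannian 𝓘(ℝ, E) M)
    (nabla : CovariantDerivative 𝓘(ℝ, E) E (fun x : M ↦ TangentSpace 𝓘(ℝ, E) x))
    (hsmooth : nabla.ContMDiffCovariantDerivative ∞)
    (hmetric : IsMetricConnection nabla)
    (hskew : HasSkewTorsion nabla)
    (hflat : IsFlatConnection nabla) :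
    IsParallelTensor nabla (riemannTensor 𝓘(ℝ, E)) ∧
    IsParallelTensor (leviCivita 𝓘(ℝ, E)) (riemannTensor 𝓘(ℝ, E) (M := M)) ∧
    (∀ (x : M) (X u v w z : TangentSpace 𝓘(ℝ, E) x),
      tensorBracket (nabla.torsion x X) (riemannTensor 𝓘(ℝ, E) x) u v w z = 0) ∧
    (∀ (U : Set M), IsOpen U → IsPreconnected U →
      ∀ e : Fin (Module.finrank ℝ E) → Π x : M, TangentSpace 𝓘(ℝ, E) x,
        IsParallelOrthonormalFrameOn nabla U e →
          (∀ i, IsKillingOn (e i) U) ∧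
          ∀ i j k l, ∀ x ∈ U, ∀ y ∈ U,
            riemannTensor 𝓘(ℝ, E) x (e i x) (e j x) (e k x) (e l x) =
              riemannTensor 𝓘(ℝ, E) y (e i y) (e j y) (e k y) (e l y)) := by
  refine ⟨isParallelTensor_riemannTensor hmetric hskew hflat hsmooth,
    isParallelTensor_leviCivita_riemannTensor hmetric hskew hflat hsmooth,
    tensorBracket_torsion_riemannTensor hmetric hskew hflat hsmooth, fun U hU hU' e he ↦
    ⟨fun i ↦ isKillingOn_of_parallel hmetric hskew
      (fun x hx ↦ ((he.smooth i).contMDiffAt (hU.mem_nhds hx)).mdifferentiableAt (by simp))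
      (he.parallel i), fun i j k l x hx y hy ↦ ?_⟩⟩
  exact hU'.eq_of_hasMFDerivAt_zero hU
    (f := fun x ↦ riemannTensor 𝓘(ℝ, E) x (e i x) (e j x) (e k x) (e l x)) (fun z hz ↦
    (isParallelTensor_riemannTensor hmetric hskew hflat hsmooth).hasMFDerivAt_zero
      (riemannTensor_zero hmetric hskew hflat hsmooth z) (hU.mem_nhds hz) (he.smooth i)
      (he.smooth j) (he.smooth k) (he.smooth l) (he.parallel i z hz) (he.parallel j z hz)
      (he.parallel k z hz) (he.parallel l z hz)) hx hy
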